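/- Let $k$ be a field of characteristic $0$, endowed with the discrete topology. For a locally finite poset $P$ and an order compatible equivalence relation $\sim$ on the set of its intervals $[x,y]$, $x\le y$ (i.e. the convolution $(fg)(x,y)=\sum_{x\le z\le y}f(x,z)g(z,y)$ of two functions that are constant on the equivalence classes is again constant on the equivalence classes), the reduced incidence algebra ${\bf R}(P,\sim)$ is the algebra of all $k$-valued functions on the set of types (equivalence classes of intervals), with product $$(fg)(\overline{[x,y]})=\sum_{x\le z\le y}f(\overline{[x,z]})\,g(\overline{[z,y]}),$$ and with the topology of pointwise convergence. In each case below, all one-point intervals have the same type, and $k$ is made a bimodule over $\mathcal A$ (trivial coefficients) through the homomorphism $\varepsilon:\mathcal A\to k$ that evaluates a function at that type. The continuous Hochschild cohomology $HH^*_{\rm cts}(\mathcal A,k)$ is the cohomology of the complex whose $n$-cochains are the continuous $k$-multilinear maps $\mathcal A^n\to k$, with the differential $$(df)(a_0,\dots,a_n)=\varepsilon(a_0)f(a_1,\dots,a_n)+\sum_{j=0}^{n-1}(-1)^{j+1}f(a_0,\dots,a_ja_{j+1},\dots,a_n)+(-1)^{n+1}f(a_0,\dots,a_{n-1})\varepsilon(a_n).$$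 **Theorem.** Let $\mathcal A$ be one of the following reduced incidence algebras: 1. ${\bf R}(B(S),\sim)$, where $B(S)$ is the poset of finite subsets of a countably infinite set $S$, ordered by inclusion, and $\sim$ is isomorphism of intervals (exponential power series); 2. ${\bf R}(\mathbb Z^{\ge 0},\sim)$, with the usual order and isomorphism of intervals (formal power series); 3. ${\bf R}(L(V),\sim)$, where $V$ is a vector space of countably infinite dimension over a finite field, $L(V)$ is the lattice of its finite-dimensional subspaces, and $[X,Y]\sim[U,W]$ if and only if $Y/X\cong W/U$ (Eulerian power series); 4. ${\bf R}(P,\sim)$, where $P$ is a locally finite poset whose Hasse diagram, as an undirected graph, is a forest of infinite depth (i.e. the lengths $n$ of the oriented paths $x_0\lessdot x_1\lessdot\dots\lessdot x_n$ in the Hasse diagram are unbounded) and $\sim$ is isomorphism of intervals. Then, as $k$-vector spaces, $$HH^n_{\rm cts}(\mathcal A,k)\cong\begin{cases}k & \text{if } n=0,\\ k & \text{if } n=1,\\ 0 & \text{if } n\ge 2.\end{cases}$$ -/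

import Mathlib

universe u v w

set_option linter.unusedSectionVars false

/-! ## Types of intervals and reduced incidence algebras -/

section Reduced

variable (k : Type u) [Field k] {P : Type v} [PartialOrder P]

/-- An equivalence relation on the intervals `[x, y]`, `x ≤ y`, of a locally finite poset is order
compatible if the convolution of two elements of the incidence algebra that are constant on the
equivalence classes is again constant on the equivalence classes. -/
class OrderCompatible [LocallyFiniteOrder P] (s : Setoid (NonemptyInterval P)) : Prop where
  mul_eq : ∀ f g : IncidenceAlgebra k P,
    (∀ I J, s I J → f I.fst I.snd = f J.fst J.snd) →
    (∀ I J, s I J → g I.fst I.snd = g J.fst J.snd) →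
    ∀ I J, s I J → (f * g) I.fst I.snd = (f * g) J.fst J.snd

/-- The reduced incidence algebra `R(P, ∼)`: all functions on the set of types, a type being an
equivalence class of intervals. -/
def ReducedIncidenceAlgebra (s : Setoid (NonemptyInterval P)) : Type (max u v) :=
  Quotient s → k

namespace ReducedIncidenceAlgebra

variable {k} {s : Setoid (NonemptyInterval P)}

instance : AddCommGroup (ReducedIncidenceAlgebra k s) :=
  inferInstanceAs (AddCommGroup (Quotient s → k))

instance : Module k (ReducedIncidenceAlgebra k s) :=
  inferInstanceAs (Module k (Quotient s → k))

/-- The topology of pointwise convergence on types. -/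
instance [TopologicalSpace k] : TopologicalSpace (ReducedIncidenceAlgebra k s) :=
  inferInstanceAs (TopologicalSpace (Quotient s → k))

/-- The value of `f` on the type of the interval `[x, y]` (and `0` if `x ≰ y`). -/
noncomputable def hat (f : ReducedIncidenceAlgebra k s) : IncidenceAlgebra k P :=
  open Classical in
  ⟨fun x y => if h : x ≤ y then f (Quotient.mk s ⟨(x, y), h⟩) else 0, fun _ _ h => dif_neg h⟩

theorem hat_apply (f : ReducedIncidenceAlgebra k s) (I : NonemptyInterval P) :
    f.hat I.fst I.snd = f (Quotient.mk s I) := dif_pos I.fst_le_snd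

theorem hat_const (f : ReducedIncidenceAlgebra k s) (I J : NonemptyInterval P) (h : s I J) :
    f.hat I.fst I.snd = f.hat J.fst J.snd := by
  rw [hat_apply, hat_apply, Quotient.sound h]

theorem hat_injective : Function.Injective (hat : ReducedIncidenceAlgebra k s → _) := by
  intro f g h
  funext α
  induction α using Quotient.inductionOn with
  | h I => exact (hat_apply f I).symm.trans ((congrArg (fun q => q I.fst I.snd) h).trans (hat_apply g I))

theorem hat_add (f g : ReducedIncidenceAlgebra k s) : (f + g).hat = f.hat + g.hat := by
  ext x y h
  rw [IncidenceAlgebra.add_apply]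
  have := fun f : ReducedIncidenceAlgebra k s => hat_apply f ⟨(x, y), h⟩
  simp only at this
  rw [this, this, this]; rfl

theorem hat_smul (c : k) (f : ReducedIncidenceAlgebra k s) : (c • f).hat = c • f.hat := by
  ext x y h
  rw [IncidenceAlgebra.constSMul_apply]
  have := fun f : ReducedIncidenceAlgebra k s => hat_apply f ⟨(x, y), h⟩
  simp only at this
  rw [this, this]; rfl

section Mul

variable [LocallyFiniteOrder P]

/-- An interval equivalent to a one-point interval is a one-point interval. -/
theorem _root_.OrderCompatible.eq_of_eq [CharZero k] [OrderCompatible k s]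
    {I J : NonemptyInterval P} (h : s I J) (hI : I.fst = I.snd) : J.fst = J.snd := by
  classical
  have hz : ∀ K : NonemptyInterval P, IncidenceAlgebra.zeta k K.fst K.snd = 1 := fun K => by
    simp [IncidenceAlgebra.zeta_apply, K.fst_le_snd]
  have key := OrderCompatible.mul_eq (s := s) (IncidenceAlgebra.zeta k) (IncidenceAlgebra.zeta k)
    (fun K L _ => by rw [hz, hz]) (fun K L _ => by rw [hz, hz]) I J h
  rw [IncidenceAlgebra.zeta_mul_zeta, IncidenceAlgebra.zeta_mul_zeta] at key
  have hc : (Finset.Icc J.fst J.snd).card = 1 := by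
    have := Nat.cast_injective (R := k) key
    rw [← this, hI]; simp
  exact Finset.card_le_one.1 hc.le _ (Finset.left_mem_Icc.2 J.fst_le_snd) _
    (Finset.right_mem_Icc.2 J.fst_le_snd)

variable [OrderCompatible k s]

/-- The product of the reduced incidence algebra. Its value at the type of `[x, y]` is the sum of
`f (type of [x, z]) * g (type of [z, y])` over all `z ∈ [x, y]`; this is the sum over all pairs of
types `β, γ` of `f β * g γ`, weighted by the number of `z ∈ [x, y]` such that `[x, z]` has
type `β` and `[z, y]` has type `γ`. -/
noncomputable instance : Mul (ReducedIncidenceAlgebra k s) where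
  mul f g := Quotient.lift (fun I : NonemptyInterval P => (f.hat * g.hat) I.fst I.snd)
    (OrderCompatible.mul_eq f.hat g.hat f.hat_const g.hat_const)

theorem mul_mk (f g : ReducedIncidenceAlgebra k s) (I : NonemptyInterval P) :
    (f * g) (Quotient.mk s I) = ∑ z ∈ Finset.Icc I.fst I.snd, f.hat I.fst z * g.hat z I.snd := rfl

theorem hat_mul (f g : ReducedIncidenceAlgebra k s) : (f * g).hat = f.hat * g.hat := by
  ext x y h
  exact hat_apply (f * g) ⟨(x, y), h⟩

variable [CharZero k]

open Classical in
/-- The unit: the function with value `1` on the types of the one-point intervals and `0` on all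
other types. -/
noncomputable instance : One (ReducedIncidenceAlgebra k s) where
  one :=
    Quotient.lift (fun I : NonemptyInterval P => if I.fst = I.snd then (1 : k) else 0)
      (fun I J h => by
        have h' : s J I := s.symm h
        have : I.fst = I.snd ↔ J.fst = J.snd :=
          ⟨OrderCompatible.eq_of_eq (k := k) h, OrderCompatible.eq_of_eq (k := k) h'⟩
        exact if_congr this rfl rfl)

open Classical in
theorem hat_one : (1 : ReducedIncidenceAlgebra k s).hat = 1 := by
  ext x y h
  rw [IncidenceAlgebra.one_apply]
  exact hat_apply (1 : ReducedIncidenceAlgebra k s) ⟨(x, y), h⟩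

noncomputable instance : Ring (ReducedIncidenceAlgebra k s) :=
  { (inferInstance : AddCommGroup (ReducedIncidenceAlgebra k s)) with
    mul := (· * ·)
    one := 1
    left_distrib := fun f g h => hat_injective (by simp only [hat_mul, hat_add, mul_add])
    right_distrib := fun f g h => hat_injective (by simp only [hat_mul, hat_add, add_mul])
    zero_mul := fun f => by
      have h0 : (0 : ReducedIncidenceAlgebra k s) = (0 : k) • 0 := (zero_smul k _).symm
      exact hat_injective (by rw [hat_mul, h0, hat_smul, zero_smul, zero_mul])
    mul_zero := fun f => by
      have h0 : (0 : ReducedIncidenceAlgebra k s) = (0 : k) • 0 := (zero_smul k _).symm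
      exact hat_injective (by rw [hat_mul, h0, hat_smul, zero_smul, mul_zero])
    mul_assoc := fun f g h => hat_injective (by classical simp only [hat_mul, mul_assoc])
    one_mul := fun f => hat_injective (by classical rw [hat_mul, hat_one, one_mul])
    mul_one := fun f => hat_injective (by classical rw [hat_mul, hat_one, mul_one]) }

noncomputable instance : Algebra k (ReducedIncidenceAlgebra k s) :=
  Algebra.ofModule
    (fun c f g => hat_injective (by
      ext x y h
      simp only [hat_mul, hat_smul, IncidenceAlgebra.mul_apply, IncidenceAlgebra.constSMul_apply,
        smul_eq_mul, Finset.mul_sum, mul_assoc]))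
    (fun c f g => hat_injective (by
      ext x y h
      simp only [hat_mul, hat_smul, IncidenceAlgebra.mul_apply, IncidenceAlgebra.constSMul_apply,
        smul_eq_mul, Finset.mul_sum, mul_left_comm]))

/-- Evaluation at the type of the one-point interval `[x, x]`. -/
noncomputable def augmentation (k : Type u) [Field k] [CharZero k]
    (s : Setoid (NonemptyInterval P)) [OrderCompatible k s] (x : P) :
    ReducedIncidenceAlgebra k s →ₐ[k] k :=
  AlgHom.ofLinearMap
    { toFun := fun f => f (Quotient.mk s (NonemptyInterval.pure x))
      map_add' := fun _ _ => rfl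
      map_smul' := fun _ _ => rfl }
    (by
      change (1 : ReducedIncidenceAlgebra k s) (Quotient.mk s (NonemptyInterval.pure x)) = 1
      exact if_pos rfl)
    (fun f g => by
      change (f * g) (Quotient.mk s (NonemptyInterval.pure x)) = _
      rw [mul_mk]
      simp only [NonemptyInterval.pure, Finset.Icc_self, Finset.sum_singleton]
      have := fun f : ReducedIncidenceAlgebra k s => hat_apply f (NonemptyInterval.pure x)
      simp only [NonemptyInterval.pure] at this
      rw [this, this]; rfl)

theorem continuous_augmentation [TopologicalSpace k] (x : P) :
    Continuous (augmentation k s x) :=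
  continuous_apply (A := fun _ : Quotient s => k) (Quotient.mk s (NonemptyInterval.pure x))

end Mul

theorem continuous_hat_apply [TopologicalSpace k] (x y : P) :
    Continuous fun f : ReducedIncidenceAlgebra k s => f.hat x y := by
  by_cases h : x ≤ y
  · have : (fun f : ReducedIncidenceAlgebra k s => f.hat x y) =
        fun f => f (Quotient.mk s ⟨(x, y), h⟩) := funext fun f => hat_apply f ⟨(x, y), h⟩
    rw [this]
    exact continuous_apply (A := fun _ : Quotient s => k) _
  · have : (fun f : ReducedIncidenceAlgebra k s => f.hat x y) = fun _ => 0 :=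
      funext fun f => IncidenceAlgebra.apply_eq_zero_of_not_le h _
    rw [this]
    exact continuous_const

instance [TopologicalSpace k] [IsTopologicalRing k] [LocallyFiniteOrder P]
    [OrderCompatible k s] : ContinuousMul (ReducedIncidenceAlgebra k s) where
  continuous_mul := by
    refine continuous_pi (A := fun _ : Quotient s => k) fun α => ?_
    induction α using Quotient.inductionOn with
    | h I =>
      change Continuous fun p : ReducedIncidenceAlgebra k s × ReducedIncidenceAlgebra k s =>
        ∑ z ∈ Finset.Icc I.fst I.snd, p.1.hat I.fst z * p.2.hat z I.snd
      exact continuous_finsetSum _ fun z _ =>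
        ((continuous_hat_apply _ _).comp continuous_fst).mul
          ((continuous_hat_apply _ _).comp continuous_snd)

end ReducedIncidenceAlgebra

end Reduced

/-! ## The equivalence relations -/

section Iso

variable (P : Type v) [PartialOrder P]

/-- Isomorphism of intervals: `[x, y] ∼ [u, v]` if they are isomorphic as posets. -/
def isoSetoid : Setoid (NonemptyInterval P) where
  r I J := Nonempty (Set.Icc I.fst I.snd ≃o Set.Icc J.fst J.snd)
  iseqv := ⟨fun _ => ⟨OrderIso.refl _⟩, fun ⟨e⟩ => ⟨e.symm⟩, fun ⟨e⟩ ⟨f⟩ => ⟨e.trans f⟩⟩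

variable {P}

/-- A criterion for order compatibility: a bijection of intervals that preserves the types of the
lower and of the upper part. -/
theorem orderCompatible_of_bij (k : Type u) [Field k] [LocallyFiniteOrder P]
    {s : Setoid (NonemptyInterval P)}
    (H : ∀ I J, s I J → ∃ e : Set.Icc I.fst I.snd ≃ Set.Icc J.fst J.snd,
      ∀ z : Set.Icc I.fst I.snd, s ⟨(I.fst, z.1), z.2.1⟩ ⟨(J.fst, (e z).1), (e z).2.1⟩ ∧
      s ⟨(z.1, I.snd), z.2.2⟩ ⟨((e z).1, J.snd), (e z).2.2⟩) :
    OrderCompatible k s where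
  mul_eq f g hf hg I J h := by
    obtain ⟨e, he⟩ := H I J h
    have key : ∀ K : NonemptyInterval P, (f * g) K.fst K.snd =
        ∑ z : {z // z ∈ Finset.Icc K.fst K.snd}, f K.fst z * g z K.snd := fun K => by
      rw [IncidenceAlgebra.mul_apply, ← Finset.sum_coe_sort]
    rw [key, key]
    have eqv : ∀ K : NonemptyInterval P, ∀ z, z ∈ Finset.Icc K.fst K.snd ↔
      z ∈ Set.Icc K.fst K.snd := fun K z => by simp
    refine Fintype.sum_equiv ((Equiv.subtypeEquivRight (eqv I)).trans
      (e.trans (Equiv.subtypeEquivRight (eqv J)).symm)) _ _ fun z => ?_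
    have hz := he ⟨z.1, (eqv I _).1 z.2⟩
    exact congrArg₂ (· * ·) (hf _ _ hz.1) (hg _ _ hz.2)

instance (k : Type u) [Field k] [LocallyFiniteOrder P] : OrderCompatible k (isoSetoid P) :=
  orderCompatible_of_bij k fun I J ⟨e⟩ => ⟨e.toEquiv, fun z => ⟨⟨
    { toFun := fun t => ⟨e ⟨t, t.2.1, t.2.2.trans z.2.2⟩,
        (e ⟨t, t.2.1, t.2.2.trans z.2.2⟩).2.1, e.monotone t.2.2⟩
      invFun := fun t => ⟨e.symm ⟨t, t.2.1, t.2.2.trans (e z).2.2⟩,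
        (e.symm ⟨t, t.2.1, t.2.2.trans (e z).2.2⟩).2.1,
        e.symm_apply_le.2 t.2.2⟩
      left_inv := fun t => Subtype.ext (by
        have := congrArg Subtype.val (e.symm_apply_apply ⟨t, t.2.1, t.2.2.trans z.2.2⟩)
        exact this)
      right_inv := fun t => Subtype.ext (by
        have := congrArg Subtype.val (e.apply_symm_apply ⟨t, t.2.1, t.2.2.trans (e z).2.2⟩)
        exact this)
      map_rel_iff' := by
        intro a b
        exact e.le_iff_le }⟩, ⟨
    { toFun := fun t => ⟨e ⟨t, z.2.1.trans t.2.1, t.2.2⟩,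
        e.monotone t.2.1, (e ⟨t, z.2.1.trans t.2.1, t.2.2⟩).2.2⟩
      invFun := fun t => ⟨e.symm ⟨t, (e z).2.1.trans t.2.1, t.2.2⟩,
        e.le_symm_apply.2 t.2.1,
        (e.symm ⟨t, (e z).2.1.trans t.2.1, t.2.2⟩).2.2⟩
      left_inv := fun t => Subtype.ext (by
        have := congrArg Subtype.val (e.symm_apply_apply ⟨t, z.2.1.trans t.2.1, t.2.2⟩)
        exact this)
      right_inv := fun t => Subtype.ext (by
        have := congrArg Subtype.val (e.apply_symm_apply ⟨t, (e z).2.1.trans t.2.1, t.2.2⟩)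
        exact this)
      map_rel_iff' := by
        intro a b
        exact e.le_iff_le }⟩⟩⟩

end Iso

section Subspaces

variable (F : Type v) [Field F] (V : Type w) [AddCommGroup V] [Module F V]

/-- The lattice `L(V)` of finite-dimensional subspaces of `V`, ordered by inclusion. -/
abbrev FinDimSubspace : Type w := {W : Submodule F V // FiniteDimensional F W}

/-- Over a finite field, `L(V)` is locally finite. -/
noncomputable instance [Finite F] : LocallyFiniteOrder (FinDimSubspace F V) :=
  LocallyFiniteOrder.ofFiniteIcc fun X Y => by
    have : FiniteDimensional F Y.1 := Y.2
    have : Finite Y.1 := Module.finite_of_finite F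
    have hY : (Y.1 : Set V).Finite := Set.toFinite _
    refine Set.Finite.of_finite_image (f := fun Z : FinDimSubspace F V => (Z.1 : Set V))
      (hY.finite_subsets.subset ?_) ?_
    · rintro _ ⟨Z, hZ, rfl⟩
      exact hZ.2
    · intro Z _ Z' _ h
      exact Subtype.ext (SetLike.coe_injective h)

/-- The zero subspace, as an element of `L(V)`. -/
def zeroSubspace : FinDimSubspace F V := ⟨⊥, inferInstance⟩

/-- The relation `[X, Y] ∼ [U, W]` if `Y / X ≅ W / U` as vector spaces. -/
def quotientSetoid : Setoid (NonemptyInterval (FinDimSubspace F V)) where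
  r I J := Nonempty ((I.snd.1 ⧸ I.fst.1.submoduleOf I.snd.1) ≃ₗ[F]
    (J.snd.1 ⧸ J.fst.1.submoduleOf J.snd.1))
  iseqv := ⟨fun _ => ⟨LinearEquiv.refl _ _⟩, fun ⟨e⟩ => ⟨e.symm⟩, fun ⟨e⟩ ⟨f⟩ => ⟨e.trans f⟩⟩

namespace FinDimSubspace

variable {F V}

/-- For `X ≤ Z ≤ Y`, the image of `Z` in `Y / X`. -/
def toQuot (X Z Y : Submodule F V) : Submodule F (Y ⧸ X.submoduleOf Y) :=
  (Z.submoduleOf Y).map (X.submoduleOf Y).mkQ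

theorem mem_toQuot {X Z Y : Submodule F V} (hX : X ≤ Z) (y : Y) :
    (X.submoduleOf Y).mkQ y ∈ toQuot X Z Y ↔ y.1 ∈ Z := by
  constructor
  · rintro ⟨z, hz, h⟩
    have h1 : z - y ∈ X.submoduleOf Y := (Submodule.Quotient.eq _).1 h
    have h2 : z.1 - y.1 ∈ Z := hX h1
    have h3 : z.1 ∈ Z := hz
    simpa using Z.sub_mem h3 h2
  · intro h
    exact ⟨y, h, rfl⟩

/-- `Z / X` is isomorphic to the image of `Z` in `Y / X`. -/
theorem nonempty_quot_equiv {X Z Y : Submodule F V} (hZ : Z ≤ Y) :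
    Nonempty ((Z ⧸ X.submoduleOf Z) ≃ₗ[F] toQuot X Z Y) := by
  let f : Z →ₗ[F] (Y ⧸ X.submoduleOf Y) := (X.submoduleOf Y).mkQ ∘ₗ Submodule.inclusion hZ
  have hk : LinearMap.ker f = X.submoduleOf Z := by
    ext z
    exact LinearMap.mem_ker.trans (Submodule.Quotient.mk_eq_zero _)
  have hr : LinearMap.range f = toQuot X Z Y := by
    ext q
    constructor
    · rintro ⟨z, rfl⟩
      exact ⟨Submodule.inclusion hZ z, z.2, rfl⟩
    · rintro ⟨y, hy, rfl⟩
      exact ⟨⟨y.1, hy⟩, rfl⟩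
  exact ⟨(Submodule.quotEquivOfEq _ _ hk.symm).trans
    (f.quotKerEquivRange.trans (LinearEquiv.ofEq _ _ hr))⟩

/-- The subspace between `X` and `Y` with a given image in `Y / X`. -/
def ofQuot (X Y : Submodule F V) (Q : Submodule F (Y ⧸ X.submoduleOf Y)) : Submodule F V :=
  (Q.comap (X.submoduleOf Y).mkQ).map Y.subtype

theorem ofQuot_le (X Y : Submodule F V) (Q : Submodule F (Y ⧸ X.submoduleOf Y)) :
    ofQuot X Y Q ≤ Y := Submodule.map_subtype_le _ _

theorem le_ofQuot {X Y : Submodule F V} (h : X ≤ Y) (Q : Submodule F (Y ⧸ X.submoduleOf Y)) :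
    X ≤ ofQuot X Y Q := fun x hx =>
  ⟨⟨x, h hx⟩, by
    have : (X.submoduleOf Y).mkQ ⟨x, h hx⟩ = 0 := (Submodule.Quotient.mk_eq_zero _).2 hx
    change (X.submoduleOf Y).mkQ ⟨x, h hx⟩ ∈ Q
    rw [this]; exact Q.zero_mem, rfl⟩

theorem toQuot_ofQuot {X Y : Submodule F V} (h : X ≤ Y)
    (Q : Submodule F (Y ⧸ X.submoduleOf Y)) : toQuot X (ofQuot X Y Q) Y = Q := by
  ext q
  obtain ⟨y, rfl⟩ := (X.submoduleOf Y).mkQ_surjective q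
  rw [mem_toQuot (le_ofQuot h Q)]
  constructor
  · rintro ⟨y', hy', h'⟩
    have : y' = y := Subtype.ext h'
    exact this ▸ hy'
  · intro hy
    exact ⟨y, hy, rfl⟩

theorem ofQuot_toQuot {X Z Y : Submodule F V} (hX : X ≤ Z) (hZ : Z ≤ Y) :
    ofQuot X Y (toQuot X Z Y) = Z := by
  ext v
  constructor
  · rintro ⟨y, hy, rfl⟩
    exact (mem_toQuot hX y).1 hy
  · intro hv
    exact ⟨⟨v, hZ hv⟩, (mem_toQuot hX ⟨v, hZ hv⟩).2 hv, rfl⟩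

/-- The interval `[X, Y]` in `L(V)` is in bijection with the subspaces of `Y / X`. -/
def iccEquiv (I : NonemptyInterval (FinDimSubspace F V)) :
    Set.Icc I.fst I.snd ≃ Submodule F (I.snd.1 ⧸ I.fst.1.submoduleOf I.snd.1) where
  toFun Z := toQuot I.fst.1 Z.1.1 I.snd.1
  invFun Q := ⟨⟨ofQuot I.fst.1 I.snd.1 Q,
    haveI := I.snd.2; Submodule.finiteDimensional_of_le (ofQuot_le _ _ Q)⟩,
    le_ofQuot I.fst_le_snd Q, ofQuot_le _ _ Q⟩
  left_inv Z := Subtype.ext (Subtype.ext (ofQuot_toQuot Z.2.1 Z.2.2))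
  right_inv Q := toQuot_ofQuot I.fst_le_snd Q

/-- `Y / Z` is isomorphic to the quotient of `Y / X` by the image of `Z`. -/
theorem nonempty_quot_quot_equiv {X Z Y : Submodule F V} (hX : X ≤ Z) :
    Nonempty ((Y ⧸ Z.submoduleOf Y) ≃ₗ[F] ((Y ⧸ X.submoduleOf Y) ⧸ toQuot X Z Y)) :=
  ⟨(Submodule.quotientQuotientEquivQuotient (X.submoduleOf Y) (Z.submoduleOf Y)
    (Submodule.comap_mono hX)).symm⟩

end FinDimSubspace

open FinDimSubspace in
instance (k : Type u) [Field k] [Finite F] : OrderCompatible k (quotientSetoid F V) :=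
  orderCompatible_of_bij k fun I J ⟨e⟩ => by
    let E : Set.Icc I.fst I.snd ≃ Set.Icc J.fst J.snd :=
      (iccEquiv I).trans ((Submodule.orderIsoMapComap e).toEquiv.trans (iccEquiv J).symm)
    refine ⟨E, fun Z => ?_⟩
    have hE : toQuot J.fst.1 (E Z).1.1 J.snd.1 = (toQuot I.fst.1 Z.1.1 I.snd.1).map e.toLinearMap :=
      (iccEquiv J).apply_symm_apply _
    obtain ⟨a⟩ := nonempty_quot_equiv (X := I.fst.1) Z.2.2
    obtain ⟨b⟩ := nonempty_quot_equiv (X := J.fst.1) (E Z).2.2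
    obtain ⟨c⟩ := nonempty_quot_quot_equiv (Y := I.snd.1) Z.2.1
    obtain ⟨d⟩ := nonempty_quot_quot_equiv (Y := J.snd.1) (E Z).2.1
    exact ⟨⟨a.trans ((e.submoduleMap _).trans ((LinearEquiv.ofEq _ _ hE.symm).trans b.symm))⟩,
      ⟨c.trans ((Submodule.Quotient.equiv _ _ e hE.symm).trans d.symm)⟩⟩

end Subspaces

/-! ## Forests -/

/-- The depth of the Hasse diagram of a poset: the supremum of the lengths of its oriented paths
`x₀ ⋖ x₁ ⋖ ⋯ ⋖ xₙ`. -/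
noncomputable def hasseDepth (P : Type v) [PartialOrder P] : ℕ∞ :=
  ⨆ p : RelSeries {(x, y) : P × P | x ⋖ y}, (p.length : ℕ∞)

/-! ## Continuous Hochschild cohomology with trivial coefficients -/

namespace Hochschild

theorem contractNth_update {A : Type w} [Ring A] {n : ℕ} (j : Fin n) (a : Fin (n + 1) → A)
    (i : Fin (n + 1)) :
    ∃ (i' : Fin n) (b c : A), ∀ x : A,
      Fin.contractNth j.castSucc (· * ·) (Function.update a i x) =
        Function.update (Fin.contractNth j.castSucc (· * ·) a) i' (b * x * c) := by
  obtain ⟨j, hj⟩ := j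
  obtain ⟨i, hi⟩ := i
  have aux : ∀ (t s : ℕ) (ht : t < n + 1) (hs : s < n + 1) (x : A),
      Function.update a ⟨t, ht⟩ x ⟨s, hs⟩ = if s = t then x else a ⟨s, hs⟩ := fun t s ht hs x => by
    simp [Function.update_apply]
  have aux' : ∀ (g : Fin n → A) (t s : ℕ) (ht : t < n) (hs : s < n) (x : A),
      Function.update g ⟨t, ht⟩ x ⟨s, hs⟩ = if s = t then x else g ⟨s, hs⟩ :=
    fun g t s ht hs x => by simp [Function.update_apply]
  rcases lt_trichotomy i j with h | rfl | h
  · refine ⟨⟨i, by omega⟩, 1, 1, fun x => ?_⟩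
    ext ⟨t, ht⟩
    simp only [Fin.contractNth, aux, aux', Fin.castSucc_mk, Fin.succ_mk, one_mul, mul_one]
    grind
  · refine ⟨⟨i, by omega⟩, 1, a ⟨i + 1, by omega⟩, fun x => ?_⟩
    ext ⟨t, ht⟩
    simp only [Fin.contractNth, aux, aux', Fin.castSucc_mk, Fin.succ_mk, one_mul]
    grind
  · by_cases h' : i = j + 1
    · subst h'
      refine ⟨⟨j, by omega⟩, a ⟨j, by omega⟩, 1, fun x => ?_⟩
      ext ⟨t, ht⟩
      simp only [Fin.contractNth, aux, aux', Fin.castSucc_mk, Fin.succ_mk, mul_one]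
      grind
    · refine ⟨⟨i - 1, by omega⟩, 1, 1, fun x => ?_⟩
      ext ⟨t, ht⟩
      simp only [Fin.contractNth, aux, aux', Fin.castSucc_mk, Fin.succ_mk, one_mul, mul_one]
      grind

section Complex

variable {k : Type u} [Field k] [TopologicalSpace k] [IsTopologicalRing k]
  {A : Type w} [Ring A] [Algebra k A] [TopologicalSpace A] [ContinuousMul A]

variable (k A) in
/-- The continuous `n`-cochains of `A` with values in `k`: the continuous `k`-multilinear maps
`A × ⋯ × A → k` (`n` factors). -/
def Cochain (n : ℕ) : Type (max u w) := ContinuousMultilinearMap k (fun _ : Fin n => A) k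

instance (n : ℕ) : FunLike (Cochain k A n) (Fin n → A) k :=
  inferInstanceAs (FunLike (ContinuousMultilinearMap k (fun _ : Fin n => A) k) (Fin n → A) k)

instance (n : ℕ) : AddCommGroup (Cochain k A n) :=
  inferInstanceAs (AddCommGroup (ContinuousMultilinearMap k (fun _ : Fin n => A) k))

instance (n : ℕ) : Module k (Cochain k A n) :=
  inferInstanceAs (Module k (ContinuousMultilinearMap k (fun _ : Fin n => A) k))

/-- The Hochschild coboundary of an `n`-cochain with values in the bimodule `k` on which `A` acts
from both sides through `ε : A → k`. -/
def coboundaryFun (ε : A →ₐ[k] k) {n : ℕ} (f : ContinuousMultilinearMap k (fun _ : Fin n => A) k) (a : Fin (n + 1) → A) : k :=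
  ε (a 0) * f (fun i => a i.succ)
    + ∑ j : Fin n, (-1) ^ (j.val + 1) * f (Fin.contractNth j.castSucc (· * ·) a)
    + (-1) ^ (n + 1) * (f (fun i => a i.castSucc) * ε (a (Fin.last n)))

theorem coboundaryFun_update (ε : A →ₐ[k] k) {n : ℕ} (f : ContinuousMultilinearMap k (fun _ : Fin n => A) k) (a : Fin (n + 1) → A)
    (i : Fin (n + 1)) :
    ∃ L : A →ₗ[k] k, ∀ x, coboundaryFun ε f (Function.update a i x) = L x := by
  have h0 : ∃ L : A →ₗ[k] k, ∀ x, ε (Function.update a i x 0) *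
      f (fun t => Function.update a i x t.succ) = L x := by
    refine Fin.cases ?_ (fun i => ?_) i
    · exact ⟨(LinearMap.mulRight k (f fun t => a t.succ)).comp ε.toLinearMap, fun x => by simp⟩
    · refine ⟨(ε (a 0)) • f.toMultilinearMap.toLinearMap (fun t => a t.succ) i, fun x => ?_⟩
      have : (fun t : Fin n => Function.update a i.succ x t.succ) =
          Function.update (fun t : Fin n => a t.succ) i x := by
        ext t; simp [Function.update_apply]
      rw [this]
      simp [(Fin.succ_ne_zero i).symm]
  have h1 : ∀ j : Fin n, ∃ L : A →ₗ[k] k, ∀ x, (-1) ^ (j.val + 1) *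
      f (Fin.contractNth j.castSucc (· * ·) (Function.update a i x)) = L x := fun j => by
    obtain ⟨i', b, c, h⟩ := contractNth_update j a i
    refine ⟨((-1 : k) ^ (j.val + 1)) • (f.toMultilinearMap.toLinearMap
      (Fin.contractNth j.castSucc (· * ·) a) i').comp
      ((LinearMap.mulRight k c).comp (LinearMap.mulLeft k b)), fun x => ?_⟩
    rw [h]
    simp
  have h2 : ∃ L : A →ₗ[k] k, ∀ x, (-1) ^ (n + 1) *
      (f (fun t => Function.update a i x t.castSucc) *
        ε (Function.update a i x (Fin.last n))) = L x := by
    refine Fin.lastCases ?_ (fun i => ?_) i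
    · refine ⟨((-1 : k) ^ (n + 1)) •
        (LinearMap.mulLeft k (f fun t => a t.castSucc)).comp ε.toLinearMap, fun x => ?_⟩
      simp [Fin.castSucc_ne_last]
    · refine ⟨((-1 : k) ^ (n + 1) * ε (a (Fin.last n))) •
        f.toMultilinearMap.toLinearMap (fun t => a t.castSucc) i, fun x => ?_⟩
      have : (fun t : Fin n => Function.update a i.castSucc x t.castSucc) =
          Function.update (fun t : Fin n => a t.castSucc) i x := by
        ext t; simp [Function.update_apply]
      rw [this]
      simp [(Fin.castSucc_ne_last i).symm]
      ring
  obtain ⟨L0, h0⟩ := h0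
  choose L1 h1 using h1
  obtain ⟨L2, h2⟩ := h2
  exact ⟨L0 + ∑ j, L1 j + L2, fun x => by simp [coboundaryFun, h0, h1, h2]⟩

theorem continuous_coboundaryFun (ε : A →ₐ[k] k) (hε : Continuous ε) {n : ℕ}
    (f : ContinuousMultilinearMap k (fun _ : Fin n => A) k) : Continuous (coboundaryFun ε f) := by
  have hc : ∀ j : Fin n, Continuous fun a : Fin (n + 1) → A =>
      Fin.contractNth j.castSucc (· * ·) a := fun j => continuous_pi fun t => by
    unfold Fin.contractNth
    split_ifs <;> fun_prop
  unfold coboundaryFun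
  refine ((((hε.comp (continuous_apply 0)).mul (f.cont.comp ?_)).add
    (continuous_finsetSum _ fun j _ => continuous_const.mul (f.cont.comp (hc j)))).add
    (continuous_const.mul ((f.cont.comp ?_).mul (hε.comp (continuous_apply _)))))
  · fun_prop
  · fun_prop

theorem coboundaryFun_add (ε : A →ₐ[k] k) {n : ℕ}
    (f g : ContinuousMultilinearMap k (fun _ : Fin n => A) k) (a : Fin (n + 1) → A) :
    coboundaryFun ε (f + g) a = coboundaryFun ε f a + coboundaryFun ε g a := by
  simp only [coboundaryFun, add_apply, mul_add, add_mul, Finset.sum_add_distrib]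
  ring

theorem coboundaryFun_smul (ε : A →ₐ[k] k) {n : ℕ} (c : k)
    (f : ContinuousMultilinearMap k (fun _ : Fin n => A) k) (a : Fin (n + 1) → A) :
    coboundaryFun ε (c • f) a = c * coboundaryFun ε f a := by
  simp only [coboundaryFun, smul_apply, smul_eq_mul, mul_add, Finset.mul_sum]
  refine congrArg₂ (· + ·) (congrArg₂ (· + ·) (by ring)
    (Finset.sum_congr rfl fun j _ => by ring)) (by ring)

/-- The Hochschild coboundary `d : Cⁿ → Cⁿ⁺¹`,
`(d f)(a₀, …, aₙ) = ε(a₀) f(a₁, …, aₙ) + ∑ⱼ (-1)ʲ⁺¹ f(a₀, …, aⱼ aⱼ₊₁, …, aₙ)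
  + (-1)ⁿ⁺¹ f(a₀, …, aₙ₋₁) ε(aₙ)`. -/
def coboundary (ε : A →ₐ[k] k) (hε : Continuous ε) (n : ℕ) :
    Cochain k A n →ₗ[k] Cochain k A (n + 1) where
  toFun f :=
    { toFun := coboundaryFun ε f
      map_update_add' := fun {inst} a i x y => by
        obtain rfl : inst = instDecidableEqFin _ := Subsingleton.elim _ _
        obtain ⟨L, hL⟩ := coboundaryFun_update ε f a i
        rw [hL, hL, hL, map_add]
      map_update_smul' := fun {inst} a i c x => by
        obtain rfl : inst = instDecidableEqFin _ := Subsingleton.elim _ _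
        obtain ⟨L, hL⟩ := coboundaryFun_update ε f a i
        rw [hL, hL, map_smul]
      cont := continuous_coboundaryFun ε hε f }
  map_add' f g := ContinuousMultilinearMap.ext fun a => coboundaryFun_add ε f g a
  map_smul' c f := ContinuousMultilinearMap.ext fun a => coboundaryFun_smul ε c f a

theorem coboundary_apply (ε : A →ₐ[k] k) (hε : Continuous ε) (n : ℕ) (f : Cochain k A n)
    (a : Fin (n + 1) → A) :
    coboundary ε hε n f a = ε (a 0) * f (fun i => a i.succ)
      + ∑ j : Fin n, (-1) ^ (j.val + 1) * f (Fin.contractNth j.castSucc (· * ·) a)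
      + (-1) ^ (n + 1) * (f (fun i => a i.castSucc) * ε (a (Fin.last n))) := rfl

/-- The `n`-cocycles. -/
def cocycles (ε : A →ₐ[k] k) (hε : Continuous ε) (n : ℕ) : Submodule k (Cochain k A n) :=
  LinearMap.ker (coboundary ε hε n)

/-- The `n`-coboundaries. -/
def coboundaries (ε : A →ₐ[k] k) (hε : Continuous ε) : (n : ℕ) → Submodule k (Cochain k A n)
  | 0 => ⊥
  | n + 1 => LinearMap.range (coboundary ε hε n)

/-- The continuous Hochschild cohomology `HHⁿ_cts(A, k)` of `A` with coefficients in the bimodule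
`k` on which `A` acts from both sides through `ε : A → k`. -/
abbrev HHcts (ε : A →ₐ[k] k) (hε : Continuous ε) (n : ℕ) : Type (max u w) :=
  cocycles ε hε n ⧸ (coboundaries ε hε n).submoduleOf (cocycles ε hε n)

end Complex

end Hochschild

namespace ReducedIncidenceAlgebra

/-- `HHⁿ_cts(R(P, ∼), k)`, where `R(P, ∼)` acts on `k` through the evaluation at the type of the
one-point interval `[x, x]`. -/
abbrev HH (k : Type u) [Field k] [CharZero k] [TopologicalSpace k] [IsTopologicalRing k]
    {P : Type v} [PartialOrder P] [LocallyFiniteOrder P] (s : Setoid (NonemptyInterval P))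
    [OrderCompatible k s] (x : P) (n : ℕ) : Type (max u v) :=
  Hochschild.HHcts (augmentation k s x) (continuous_augmentation x) n

end ReducedIncidenceAlgebra

/-! ### Cochains and the last argument. -/

namespace Hochschild

variable {k : Type u} [Field k] [TopologicalSpace k] [IsTopologicalRing k]
  {A : Type w} [Ring A] [Algebra k A] [TopologicalSpace A] [ContinuousMul A]

/-! Each of the four algebras behaves like a (deformed) power series algebra in one variable. Let
`x` be the indicator function of the type of rank one. Then `a ↦ a * x` is injective with image the
augmentation ideal, so `0 → A → A → k → 0` is a free resolution of the left module `k` of length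
one. As `ε x = 0`, it suggests one-dimensional cohomology in degrees 0 and 1 and nothing above.

For continuous cochains this is made explicit. Division by `x` is a linear map `D` with `D a * x = a
- ε a`, and it is continuous because every value of `D f` depends on a single value of `f`. The data
are collected in `Hochschild.IsFreeGenerator`. From `D` one writes down a primitive of every cocycle
of degree at least 2 (`eq_coboundary`). A 1-cocycle is a derivation, determined by its value at `x`;
a 0-cochain is always closed.

It remains to divide by `x` in a reduced incidence algebra. Suppose that types are classified by an
additive rank that is 1 on covering pairs and unbounded (`IsIntervalRank`). An interval `[u, v]` of
rank `n + 1` gives `(f * x)([u, v]) = f(type n) * c`, where `c` is the number of coatoms. This `c`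
is positive, hence invertible in characteristic 0 (`isFreeGenerator`). The rank is the size of the
difference of two finite sets, the dimension of the quotient of two subspaces, or the length of a
chain. The last covers the integers and also forests, since uniqueness of paths makes every interval
of a forest a chain. -/

theorem contractNth_snoc_castSucc {n : ℕ} (j : Fin n) (a : Fin (n + 1) → A) (b : A) :
    Fin.contractNth j.castSucc.castSucc (· * ·) (Fin.snoc (α := fun _ => A) a b) =
      Fin.snoc (α := fun _ => A) (Fin.contractNth j.castSucc (· * ·) a) b := by
  ext t
  obtain ⟨t, ht⟩ := t
  obtain ⟨j, hj⟩ := j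
  simp only [Fin.contractNth, Fin.snoc, Fin.castSucc_mk, Fin.succ_mk, Fin.castLT_mk, cast_eq]
  grind

theorem contractNth_snoc_last {n : ℕ} (a : Fin (n + 1) → A) (b : A) :
    Fin.contractNth (Fin.last n).castSucc (· * ·) (Fin.snoc (α := fun _ => A) a b) =
      Fin.snoc (α := fun _ => A) (fun i => a i.castSucc) (a (Fin.last n) * b) := by
  ext t
  refine Fin.lastCases ?_ (fun t => ?_) t
  · rw [Fin.snoc_last, Fin.contractNth_apply_of_eq _ _ _ _ rfl, Fin.snoc_castSucc, Fin.succ_last,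
      Fin.snoc_last]
  · rw [Fin.contractNth_apply_of_lt _ _ _ _ (by simp), Fin.snoc_castSucc, Fin.snoc_castSucc]

/-- A cochain as a linear function of its last argument. -/
def lastLinear {n : ℕ} (f : Cochain k A (n + 1)) (a : Fin n → A) : A →ₗ[k] k :=
  (ContinuousMultilinearMap.toMultilinearMap f).toLinearMap (Fin.snoc (α := fun _ => A) a 0)
    (Fin.last n)

theorem lastLinear_apply {n : ℕ} (f : Cochain k A (n + 1)) (a : Fin n → A) (b : A) :
    lastLinear f a b = f (Fin.snoc (α := fun _ => A) a b) := by
  change f (Function.update _ _ _) = _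
  rw [Fin.update_snoc_last]

/-- The cochain obtained by fixing the last argument. -/
def fixLast {n : ℕ} (f : Cochain k A (n + 1)) (b : A) : Cochain k A n where
  toFun a := f (Fin.snoc (α := fun _ => A) a b)
  map_update_add' := fun {inst} a i x y => by
    obtain rfl : inst = instDecidableEqFin _ := Subsingleton.elim _ _
    simp only [Fin.snoc_update]
    exact ContinuousMultilinearMap.map_update_add f _ _ _ _
  map_update_smul' := fun {inst} a i c x => by
    obtain rfl : inst = instDecidableEqFin _ := Subsingleton.elim _ _
    simp only [Fin.snoc_update]
    exact ContinuousMultilinearMap.map_update_smul f _ _ _ _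
  cont := (ContinuousMultilinearMap.cont f).comp (by fun_prop)

theorem fixLast_apply {n : ℕ} (f : Cochain k A (n + 1)) (b : A) (a : Fin n → A) :
    fixLast f b a = f (Fin.snoc (α := fun _ => A) a b) := rfl

/-- The cochain obtained by applying a continuous linear map to the last argument. -/
def compLast {n : ℕ} (f : Cochain k A (n + 1)) (D : A →L[k] A) : Cochain k A (n + 1) :=
  ContinuousMultilinearMap.compContinuousLinearMap f
    (Fin.snoc (α := fun _ => A →L[k] A) (fun _ => ContinuousLinearMap.id k A) D)

theorem compLast_snoc {n : ℕ} (f : Cochain k A (n + 1)) (D : A →L[k] A) (a : Fin n → A) (b : A) :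
    compLast f D (Fin.snoc (α := fun _ => A) a b) = f (Fin.snoc (α := fun _ => A) a (D b)) := by
  change f _ = _
  congr 1
  ext t
  refine Fin.lastCases ?_ (fun t => ?_) t <;> simp

variable (ε : A →ₐ[k] k) (hε : Continuous ε)

/-- Splits off the last argument. The coboundary of the cochain with `b` frozen contains a final
term with `ε (a (Fin.last n))` that is absent on the left; the middle term of the bracket removes
it. The other two are the genuine terms of the differential that involve `b`. -/
theorem coboundary_snoc {n : ℕ} (f : Cochain k A (n + 1)) (a : Fin (n + 1) → A) (b : A) :
    coboundary ε hε (n + 1) f (Fin.snoc (α := fun _ => A) a b) =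
      coboundary ε hε n (fixLast f b) a
      + (-1) ^ (n + 1) * (f (Fin.snoc (α := fun _ => A) (fun i => a i.castSucc)
          (a (Fin.last n) * b))
        - f (Fin.snoc (α := fun _ => A) (fun i => a i.castSucc) b) * ε (a (Fin.last n))
        - f a * ε b) := by
  have h0 : (fun i : Fin (n + 1) => Fin.snoc (α := fun _ => A) a b i.succ) =
      Fin.snoc (α := fun _ => A) (fun i => a i.succ) b := by
    ext t
    refine Fin.lastCases ?_ (fun t => ?_) t
    · rw [Fin.succ_last, Fin.snoc_last, Fin.snoc_last]
    · rw [Fin.succ_castSucc, Fin.snoc_castSucc, Fin.snoc_castSucc]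
  have h1 : Fin.snoc (α := fun _ => A) a b 0 = a 0 := Fin.snoc_castSucc (α := fun _ => A) b a 0
  rw [coboundary_apply, coboundary_apply, Fin.sum_univ_castSucc, h0, h1]
  simp only [contractNth_snoc_castSucc, contractNth_snoc_last, Fin.snoc_castSucc, Fin.snoc_last,
    fixLast_apply, Fin.val_castSucc, Fin.val_last]
  ring

theorem ext_snoc {n : ℕ} {f g : Cochain k A (n + 1)}
    (h : ∀ (a : Fin n → A) (b : A), f (Fin.snoc (α := fun _ => A) a b) =
      g (Fin.snoc (α := fun _ => A) a b)) : f = g :=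
  ContinuousMultilinearMap.ext fun a => by
    rw [← Fin.snoc_init_self (α := fun _ => A) a]
    exact h _ _

/-- The augmentation ideal of `A` is freely generated by `x` as a left ideal, and division by `x`
is continuous. -/
structure IsFreeGenerator (x : A) (D : A →L[k] A) : Prop where
  map_eq_zero : ε x = 0
  div_mul : ∀ a, D a * x = a - ε a • 1
  eq_zero : ∀ a, a * x = 0 → a = 0

/-! ### Vanishing in degrees at least two. -/

namespace IsFreeGenerator

variable {ε} {x : A} {D : A →L[k] A} (H : IsFreeGenerator ε x D)
include H

/-- Both sides agree after right multiplication by `x`, and `x` can be cancelled. Thus `D` is a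
derivation twisted by `ε`. -/
theorem div_product (a b : A) : D (a * b) = ε b • D a + a * D b := by
  rw [← sub_eq_zero]
  apply H.eq_zero
  rw [sub_mul, add_mul, H.div_mul, smul_mul_assoc, H.div_mul, mul_assoc, H.div_mul, map_mul,
    mul_sub, mul_smul_comm, mul_one, smul_sub, smul_smul, mul_comm (ε b)]
  abel

theorem div_self : D x = 1 := by
  rw [← sub_eq_zero]
  apply H.eq_zero
  rw [sub_mul, H.div_mul, H.map_eq_zero]
  simp

/-- The primitive is, up to sign, `f(…, c, 1) - f(…, D c, x)`: it lifts the decomposition `c = ε(c)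
1 + D(c) x` of the last argument to one more variable. -/
theorem eq_coboundary {n : ℕ} (f : Cochain k A (n + 2)) (hf : coboundary ε hε (n + 2) f = 0) :
    coboundary ε hε (n + 1)
      ((-1 : k) ^ n • (fixLast f 1 - compLast (fixLast f x) D)) = f := by
  have hf' : ∀ a, coboundary ε hε (n + 2) f a = 0 := fun a => by rw [hf]; rfl
  refine ext_snoc fun a c => ?_
  -- The cocycle identity at `(a, c, 1)` and at `(a, D c, x)` computes the coboundaries of `f(…, 1)`
  -- at `(a, c)` and of `f(…, x)` at `(a, D c)`.
  have h1 := coboundary_snoc ε hε f (Fin.snoc (α := fun _ => A) a c) 1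
  have h2 := coboundary_snoc ε hε f (Fin.snoc (α := fun _ => A) a (D c)) x
  -- `D` does not commute with the coboundary. By `div_product` the defect is only the term `f(a, x)
  -- ε(D c)` up to sign, and this cancels the same term coming from `h2`.
  have h3 := coboundary_snoc ε hε (compLast (fixLast f x) D) a c
  have h4 := coboundary_snoc ε hε (fixLast f x) a (D c)
  have h5 : fixLast (compLast (fixLast f x) D) c = fixLast (fixLast f x) (D c) :=
    ContinuousMultilinearMap.ext fun a => compLast_snoc (fixLast f x) D a c
  have h6 : compLast (fixLast f x) D a = fixLast f x
      (Fin.snoc (α := fun _ => A) (fun i => a i.castSucc) (D (a (Fin.last n)))) := by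
    conv_lhs => rw [← Fin.snoc_init_self (α := fun _ => A) a]
    exact compLast_snoc _ _ _ _
  simp only [hf', Fin.snoc_castSucc, Fin.snoc_last, map_one, mul_one, H.map_eq_zero, mul_zero,
    H.div_mul, h5, h6, compLast_snoc, H.div_product] at h1 h2 h3 h4
  simp only [← lastLinear_apply, map_add, map_sub, map_smul, smul_eq_mul] at h1 h2 h3 h4
  have e : coboundary ε hε (n + 1) ((-1 : k) ^ n • (fixLast f 1 - compLast (fixLast f x) D))
      (Fin.snoc (α := fun _ => A) a c) = (-1) ^ n *
        (coboundary ε hε (n + 1) (fixLast f 1) (Fin.snoc (α := fun _ => A) a c) -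
        coboundary ε hε (n + 1) (compLast (fixLast f x) D) (Fin.snoc (α := fun _ => A) a c)) := by
    rw [map_smul, map_sub]
    rfl
  rw [e]
  have hs : ((-1 : k) ^ n) * (-1) ^ n = 1 := by rw [← mul_pow]; simp
  have h8 : fixLast f x a = lastLinear f a x := (lastLinear_apply f a x).symm
  simp only [← lastLinear_apply]
  linear_combination (-(-1) ^ n) * h1 + (-1) ^ n * h2 - (-1) ^ n * h3 + (-1) ^ n * h4 +
    lastLinear f a c * hs + (-1) ^ n * (-1) ^ n * ε (D c) * h8

theorem subsingleton_HHcts {n : ℕ} (hn : 2 ≤ n) : Subsingleton (HHcts ε hε n) := by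
  obtain ⟨n, rfl⟩ := Nat.exists_eq_add_of_le' hn
  refine Submodule.Quotient.subsingleton_iff.2 (eq_top_iff.2 fun f _ => ?_)
  exact ⟨_, H.eq_coboundary hε f.1 f.2⟩

end IsFreeGenerator

/-! ### Degrees zero and one. -/

theorem coboundary_zero : coboundary ε hε 0 = 0 := by
  refine LinearMap.ext fun f => ContinuousMultilinearMap.ext fun a => ?_
  change coboundary ε hε 0 f a = 0
  rw [coboundary_apply]
  have h : ∀ b c : Fin 0 → A, f b = f c := fun b c => congrArg f (Subsingleton.elim b c)
  -- Only the two outer terms exist; they cancel because `A` acts on `k` by the same scalar from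
  -- both sides.
  simp [h _ (fun i => a i.succ), mul_comm]

theorem nonempty_HHcts_zero_equiv : Nonempty (HHcts ε hε 0 ≃ₗ[k] k) := by
  have h1 : (coboundaries ε hε 0).submoduleOf (cocycles ε hε 0) = ⊥ := by
    simp [coboundaries, Submodule.submoduleOf]
  have h2 : cocycles ε hε 0 = ⊤ := by simp [cocycles, coboundary_zero]
  let e : Cochain k A 0 ≃ₗ[k] k :=
    { toFun f := f 0
      map_add' _ _ := rfl
      map_smul' _ _ := rfl
      invFun c := ContinuousMultilinearMap.constOfIsEmpty k (fun _ : Fin 0 => A) c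
      left_inv f := ContinuousMultilinearMap.ext fun a =>
        congrArg f (Subsingleton.elim (0 : Fin 0 → A) a)
      right_inv c := rfl }
  exact ⟨(Submodule.quotEquivOfEqBot _ h1).trans ((LinearEquiv.ofEq _ _ h2).trans
    (Submodule.topEquiv.trans e))⟩

/-- A `1`-cocycle is a derivation. -/
theorem cocycle_one_apply {f : Cochain k A 1} (hf : coboundary ε hε 1 f = 0) (a b : A) :
    f ![a * b] = ε a * f ![b] + f ![a] * ε b := by
  have h : coboundary ε hε 1 f ![a, b] = 0 := by rw [hf]; rfl
  rw [coboundary_apply] at h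
  have h1 : Fin.contractNth (0 : Fin 1).castSucc (· * ·) ![a, b] = ![a * b] := by
    ext i; fin_cases i; rfl
  have h2 : (fun i : Fin 1 => ![a, b] i.succ) = ![b] := by ext i; fin_cases i; rfl
  have h3 : (fun i : Fin 1 => ![a, b] i.castSucc) = ![a] := by ext i; fin_cases i; rfl
  rw [Fin.sum_univ_one, h1, h2, h3] at h
  simp at h
  linear_combination -h

namespace IsFreeGenerator

variable {ε} {x : A} {D : A →L[k] A} (H : IsFreeGenerator ε x D)
include H

/-- Apply the derivation `f` to `D a * x = a - ε a • 1`, using `ε x = 0` and `f 1 = 0`. -/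
theorem cocycle_one_eq {f : Cochain k A 1} (hf : coboundary ε hε 1 f = 0) (a : A) :
    f ![a] = ε (D a) * f ![x] := by
  have h1 : f ![1] = 0 := by
    have := cocycle_one_apply ε hε hf 1 1
    simpa using this
  have hl : ∀ b, f ![b] = lastLinear f ![] b := fun b => by
    rw [lastLinear_apply]
    congr 1
    ext i
    fin_cases i
    rfl
  have h2 := cocycle_one_apply ε hε hf (D a) x
  rw [H.div_mul, H.map_eq_zero, mul_zero, add_zero, hl, map_sub, map_smul, ← hl, ← hl, h1] at h2
  simpa using h2

/-- The cocycle is `ε ∘ D`: it is a derivation by `div_product`, and `D x = 1`. -/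
theorem exists_cocycle_one :
    ∃ f : Cochain k A 1, coboundary ε hε 1 f = 0 ∧ f ![x] = 1 := by
  let L : A →L[k] k := ⟨ε.toLinearMap ∘ₗ D.toLinearMap, hε.comp D.cont⟩
  let f : Cochain k A 1 := ContinuousMultilinearMap.ofSubsingleton k A k (0 : Fin 1) L
  have hf : ∀ a, f a = ε (D (a 0)) := fun a => rfl
  refine ⟨f, ContinuousMultilinearMap.ext fun a => ?_, ?_⟩
  · change coboundary ε hε 1 f a = 0
    rw [coboundary_apply, Fin.sum_univ_one, hf, hf, hf,
      Fin.contractNth_apply_of_eq _ _ _ _ rfl, H.div_product]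
    simp
    ring
  · rw [hf]
    simp [H.div_self]

theorem nonempty_HHcts_one_equiv : Nonempty (HHcts ε hε 1 ≃ₗ[k] k) := by
  have h1 : (coboundaries ε hε 1).submoduleOf (cocycles ε hε 1) = ⊥ := by
    have : coboundaries ε hε 1 = ⊥ := by simp [coboundaries, coboundary_zero]
    simp [this, Submodule.submoduleOf]
  let e : cocycles ε hε 1 →ₗ[k] k :=
    { toFun f := f.1 ![x]
      map_add' _ _ := rfl
      map_smul' _ _ := rfl }
  have he : Function.Bijective e := by
    constructor
    · refine (injective_iff_map_eq_zero e).2 fun f hf => Subtype.ext ?_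
      refine ContinuousMultilinearMap.ext fun a => ?_
      have ha : a = ![a 0] := by ext i; fin_cases i; rfl
      change f.1 a = 0
      rw [ha, H.cocycle_one_eq hε f.2]
      exact mul_eq_zero_of_right _ hf
    · obtain ⟨f, hf, hfx⟩ := H.exists_cocycle_one hε
      intro c
      refine ⟨c • ⟨f, hf⟩, ?_⟩
      rw [map_smul]
      exact (congrArg (c * ·) hfx).trans (mul_one c)
  exact ⟨(Submodule.quotEquivOfEqBot _ h1).trans (LinearEquiv.ofBijective e he)⟩

end IsFreeGenerator
end Hochschild

/-- The zeta function, as an element of the reduced incidence algebra. -/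
def ReducedIncidenceAlgebra.zeta (k : Type u) [Field k] {P : Type v} [PartialOrder P]
    (s : Setoid (NonemptyInterval P)) : ReducedIncidenceAlgebra k s := fun _ => 1

/-- A rank function on the intervals of a poset that classifies them up to the equivalence
relation `s`. -/
structure IsIntervalRank {P : Type v} [PartialOrder P] (s : Setoid (NonemptyInterval P))
    (r : NonemptyInterval P → ℕ) : Prop where
  rel_iff : ∀ I J, s I J ↔ r I = r J
  add : ∀ (x z y : P) (h : x ≤ z) (h' : z ≤ y),
    r ⟨(x, z), h⟩ + r ⟨(z, y), h'⟩ = r ⟨(x, y), h.trans h'⟩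
  covBy : ∀ (x y : P) (h : x ⋖ y), r ⟨(x, y), h.le⟩ = 1
  unbounded : ∀ n, ∃ I, n ≤ r I

/-! ### Interval ranks and division by the rank-one indicator. -/

namespace IsIntervalRank

open ReducedIncidenceAlgebra

variable {P : Type v} [PartialOrder P] [LocallyFiniteOrder P] {s : Setoid (NonemptyInterval P)}
  {r : NonemptyInterval P → ℕ} (H : IsIntervalRank s r)
include H

theorem pure (x : P) : r (NonemptyInterval.pure x) = 0 := by
  have := H.add x x x le_rfl le_rfl
  change r ⟨(x, x), _⟩ = 0
  omega

theorem exists_covBy (I : NonemptyInterval P) (hI : r I ≠ 0) :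
    ∃ z, ∃ (h : I.fst ≤ z) (h' : z ≤ I.snd), r ⟨(z, I.snd), h'⟩ = 1 ∧
      r ⟨(I.fst, z), h⟩ + 1 = r I := by
  have hne : I.fst ≠ I.snd := fun h => hI <| by
    have h2 : I = NonemptyInterval.pure I.fst := NonemptyInterval.ext (Prod.ext rfl h.symm)
    rw [h2, H.pure]
  obtain ⟨z, h, h'⟩ := (lt_of_le_of_ne I.fst_le_snd hne).exists_le_covby
  have h1 := H.covBy _ _ h'
  exact ⟨z, h, h'.le, h1, by rw [← h1, H.add]⟩

/-- Start from an interval of large rank and lower its top to a coatom repeatedly; each step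
decreases the rank by exactly one. -/
theorem exists_eq (n : ℕ) : ∃ I, r I = n := by
  obtain ⟨I, hI⟩ := H.unbounded n
  obtain ⟨m, hm⟩ := Nat.exists_eq_add_of_le hI
  induction m generalizing I with
  | zero => exact ⟨I, hm⟩
  | succ m ih =>
    obtain ⟨z, h, -, -, h1⟩ := H.exists_covBy I (by omega)
    exact ih ⟨(I.fst, z), h⟩ (by omega) (by omega)

/-- The rank of a type. -/
def rank : Quotient s → ℕ := Quotient.lift r fun I J h => (H.rel_iff I J).1 h

theorem rank_mk (I : NonemptyInterval P) : H.rank (Quotient.mk s I) = r I := rfl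

/-- The type of given rank. -/
noncomputable def type (n : ℕ) : Quotient s := Quotient.mk s (H.exists_eq n).choose

theorem mk_eq_type (I : NonemptyInterval P) {n : ℕ} (h : r I = n) :
    Quotient.mk s I = H.type n :=
  Quotient.sound ((H.rel_iff _ _).2 (h.trans (H.exists_eq n).choose_spec.symm))

theorem type_rank (α : Quotient s) : H.type (H.rank α) = α := by
  induction α using Quotient.inductionOn with
  | h I => exact (H.mk_eq_type I rfl).symm

variable (k : Type u) [Field k]

/-- The indicator function of the type of rank `1`. -/
def generator : ReducedIncidenceAlgebra k s := fun α => if H.rank α = 1 then 1 else 0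

theorem hat_generator {x y : P} (h : x ≤ y) :
    (H.generator k).hat x y = if r ⟨(x, y), h⟩ = 1 then 1 else 0 :=
  hat_apply (H.generator k) ⟨(x, y), h⟩

variable [OrderCompatible k s]

/-- The number of coatoms of an interval, as a function of its type. -/
noncomputable def coatoms : ReducedIncidenceAlgebra k s :=
  zeta k s * H.generator k

variable {k} in
-- Only the `z` for which the upper part has rank one contribute. By additivity all the lower parts
-- then have rank `n`, so the value of `f` factors out and a count of coatoms remains.
theorem mul_generator_mk (f : ReducedIncidenceAlgebra k s) (I : NonemptyInterval P) {n : ℕ}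
    (h : r I = n + 1) :
    (f * H.generator k) (Quotient.mk s I) = f (H.type n) * H.coatoms k (Quotient.mk s I) := by
  rw [coatoms, mul_mk, mul_mk, Finset.mul_sum]
  refine Finset.sum_congr rfl fun z hz => ?_
  obtain ⟨h1, h2⟩ := Finset.mem_Icc.1 hz
  rw [H.hat_generator k h2, hat_apply _ ⟨(I.fst, z), h1⟩, hat_apply _ ⟨(I.fst, z), h1⟩]
  split_ifs with h3
  · have := H.add _ _ _ h1 h2
    rw [H.mk_eq_type ⟨(I.fst, z), h1⟩ (n := n)
      (by rw [h3] at this; exact Nat.succ.inj (this.trans h)), zeta]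
    ring
  · ring

variable {k} in
theorem mul_generator_mk_of_eq_zero (f : ReducedIncidenceAlgebra k s) (I : NonemptyInterval P)
    (h : r I = 0) : (f * H.generator k) (Quotient.mk s I) = 0 := by
  rw [mul_mk]
  refine Finset.sum_eq_zero fun z hz => ?_
  obtain ⟨h1, h2⟩ := Finset.mem_Icc.1 hz
  have := H.add _ _ _ h1 h2
  rw [H.hat_generator k h2, if_neg, mul_zero]
  intro h3
  rw [h3] at this
  exact Nat.succ_ne_zero _ (this.trans h)

/-- The value is the image in `k` of a cardinality, and an interval of positive rank has at least
one coatom. -/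
theorem coatoms_ne_zero [CharZero k] (n : ℕ) : H.coatoms k (H.type (n + 1)) ≠ 0 := by
  obtain ⟨I, hI⟩ := H.exists_eq (n + 1)
  rw [← H.mk_eq_type I hI, coatoms, mul_mk]
  classical
  have h : ∀ z ∈ Finset.Icc I.fst I.snd,
      (zeta k s).hat I.fst z *
        (H.generator k).hat z I.snd =
      if ∃ h : z ≤ I.snd, r ⟨(z, I.snd), h⟩ = 1 then 1 else 0 := fun z hz => by
    obtain ⟨h1, h2⟩ := Finset.mem_Icc.1 hz
    rw [H.hat_generator k h2, hat_apply _ ⟨(I.fst, z), h1⟩, zeta, one_mul]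
    exact if_congr ⟨fun h => ⟨h2, h⟩, fun h => h.2⟩ rfl rfl
  rw [Finset.sum_congr rfl h, Finset.sum_boole]
  obtain ⟨z, h1, h2, h3, -⟩ := H.exists_covBy I (by omega)
  exact Nat.cast_ne_zero.2 (Finset.card_ne_zero_of_mem
    (Finset.mem_filter.2 ⟨Finset.mem_Icc.2 ⟨h1, h2⟩, h2, h3⟩))

variable [TopologicalSpace k] [IsTopologicalRing k]

/-- Division by the generator. -/
noncomputable def division : ReducedIncidenceAlgebra k s →L[k] ReducedIncidenceAlgebra k s where
  toFun f := fun α => (H.coatoms k (H.type (H.rank α + 1)))⁻¹ * f (H.type (H.rank α + 1))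
  map_add' f g := funext fun _ => mul_add _ (f _) (g _)
  map_smul' c f := funext fun _ => mul_left_comm _ c (f _)
  cont := continuous_pi (A := fun _ : Quotient s => k) fun _ =>
    continuous_const.mul (continuous_apply (A := fun _ : Quotient s => k) _)

theorem division_type (f : ReducedIncidenceAlgebra k s) (n : ℕ) :
    H.division k f (H.type n) = (H.coatoms k (H.type (n + 1)))⁻¹ * f (H.type (n + 1)) := by
  obtain ⟨I, hI⟩ := H.exists_eq n
  rw [← H.mk_eq_type I hI]
  subst hI
  rfl

theorem isFreeGenerator [CharZero k] (x : P) :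
    Hochschild.IsFreeGenerator (augmentation k s x) (H.generator k) (H.division k) where
  map_eq_zero := by
    change H.generator k (Quotient.mk s (NonemptyInterval.pure x)) = 0
    simp [generator, rank_mk, H.pure]
  div_mul f := by
    funext α
    induction α using Quotient.inductionOn with
    | h I =>
      change _ = f (Quotient.mk s I) - f (Quotient.mk s (NonemptyInterval.pure x)) *
        (1 : ReducedIncidenceAlgebra k s) (Quotient.mk s I)
      have h1 : (1 : ReducedIncidenceAlgebra k s) (Quotient.mk s I) =
          open Classical in if I.fst = I.snd then 1 else 0 := rfl
      rw [h1]
      cases h : r I with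
      | zero =>
        -- Rank zero is the rank of a one-point interval, so `I` has the type of one; order
        -- compatibility then forces `I` to be a single point.
        have h2 : I.fst = I.snd := by
          refine OrderCompatible.eq_of_eq (k := k) (s := s) (I := NonemptyInterval.pure x) ?_ rfl
          rw [H.rel_iff, H.pure, h]
        rw [H.mul_generator_mk_of_eq_zero _ _ h, if_pos h2, H.mk_eq_type I h,
          H.mk_eq_type _ (H.pure x)]
        ring
      | succ n =>
        have h2 : I.fst ≠ I.snd := fun h2 => by
          have h3 : I = NonemptyInterval.pure I.fst := NonemptyInterval.ext (Prod.ext rfl h2.symm)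
          rw [h3, H.pure] at h
          omega
        rw [H.mul_generator_mk _ _ h, if_neg h2, H.division_type, H.mk_eq_type I h]
        have := H.coatoms_ne_zero k n
        field_simp
        ring
  eq_zero f hf := by
    funext α
    rw [← H.type_rank α]
    -- The value of `f` at a rank is read off from `f * x` one rank higher, where an interval exists
    -- because ranks are unbounded.
    obtain ⟨I, hI⟩ := H.exists_eq (H.rank α + 1)
    have h1 := H.mul_generator_mk f I hI
    rw [hf, H.mk_eq_type I hI] at h1
    exact (mul_eq_zero.1 h1.symm).resolve_right (H.coatoms_ne_zero k _)

theorem HH_equiv [CharZero k] (x : P) :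
    Nonempty (HH k s x 0 ≃ₗ[k] k) ∧ Nonempty (HH k s x 1 ≃ₗ[k] k) ∧
      ∀ n ≥ 2, Subsingleton (HH k s x n) :=
  ⟨Hochschild.nonempty_HHcts_zero_equiv _ _,
    (H.isFreeGenerator k x).nonempty_HHcts_one_equiv _,
    fun _ hn => (H.isFreeGenerator k x).subsingleton_HHcts _ hn⟩

end IsIntervalRank

/-! ## Boolean intervals -/

/-- The interval `[X, Y]` of finite sets is isomorphic to the lattice of subsets of `Y \ X`. -/
def Finset.iccOrderIso {S : Type v} [DecidableEq S] {X Y : Finset S} (h : X ≤ Y) :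
    Set.Icc X Y ≃o Finset {a // a ∈ Y \ X} where
  toFun Z := Z.1.subtype (· ∈ Y \ X)
  invFun T := ⟨X ∪ T.map (Function.Embedding.subtype _), Finset.subset_union_left,
    Finset.union_subset h fun a ha => by
      obtain ⟨b, -, rfl⟩ := Finset.mem_map.1 ha
      exact (Finset.mem_sdiff.1 b.2).1⟩
  left_inv Z := by
    obtain ⟨Z, h1, h2⟩ := Z
    ext a
    have h3 := @h1 a
    have h4 := @h2 a
    simp
    tauto
  right_inv T := by
    ext ⟨a, ha⟩
    simp at ha
    simp [ha]
  map_rel_iff' := by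
    rintro ⟨Z, h1, h2⟩ ⟨W, h3, h4⟩
    change Finset.subtype _ Z ⊆ Finset.subtype _ W ↔ Z ⊆ W
    constructor
    · intro h a ha
      by_cases haX : a ∈ X
      · exact h3 haX
      · have := @h ⟨a, Finset.mem_sdiff.2 ⟨h2 ha, haX⟩⟩ (Finset.mem_subtype.2 ha)
        exact Finset.mem_subtype.1 this
    · intro h a ha
      exact Finset.mem_subtype.2 (h (Finset.mem_subtype.1 ha))

theorem Finset.nonempty_icc_orderIso_iff {S : Type v} [DecidableEq S] {X Y U W : Finset S}
    (h : X ≤ Y) (h' : U ≤ W) :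
    Nonempty (Set.Icc X Y ≃o Set.Icc U W) ↔ (Y \ X).card = (W \ U).card := by
  constructor
  · rintro ⟨e⟩
    have := Fintype.card_congr (((Finset.iccOrderIso h).symm.trans e).trans
      (Finset.iccOrderIso h')).toEquiv
    simp only [Fintype.card_finset, Fintype.card_coe] at this
    -- Isomorphic intervals have equally many elements, here powers of 2 whose exponents are the
    -- sizes of the differences.
    exact Nat.pow_right_injective le_rfl this
  · intro hc
    have e : {a // a ∈ Y \ X} ≃ {a // a ∈ W \ U} := Finset.equivOfCardEq hc
    refine ⟨(Finset.iccOrderIso h).trans (OrderIso.trans ?_ (Finset.iccOrderIso h').symm)⟩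
    exact { e.finsetCongr with
      map_rel_iff' := by
        intro T T'
        exact Finset.map_subset_map }

theorem isIntervalRank_finset (S : Type v) [DecidableEq S] [Infinite S] :
    IsIntervalRank (isoSetoid (Finset S)) fun I => (I.snd \ I.fst).card where
  rel_iff I J := Finset.nonempty_icc_orderIso_iff I.fst_le_snd J.fst_le_snd
  add X Z Y h h' := by
    simp only [Finset.card_sdiff_of_subset h, Finset.card_sdiff_of_subset h',
      Finset.card_sdiff_of_subset (h.trans h')]
    have := Finset.card_le_card h
    have := Finset.card_le_card h'
    omega
  covBy X Y h := (Finset.covBy_iff_card_sdiff_eq_one.1 h).2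
  unbounded n := by
    obtain ⟨Y, hY⟩ := Infinite.exists_subset_card_eq S n
    exact ⟨⟨(∅, Y), Finset.empty_subset Y⟩, by simp [hY]⟩

/-! ## Posets whose intervals are chains -/

theorem nonempty_orderIso_of_card_eq {α β : Type v} [PartialOrder α] [PartialOrder β] [Fintype α]
    [Fintype β] (hα : ∀ a b : α, a ≤ b ∨ b ≤ a) (hβ : ∀ a b : β, a ≤ b ∨ b ≤ a)
    (h : Fintype.card α = Fintype.card β) : Nonempty (α ≃o β) := by
  classical
  let A : LinearOrder α :=
    { ‹PartialOrder α› with le_total := hα, toDecidableLE := Classical.decRel _ }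
  let B : LinearOrder β :=
    { ‹PartialOrder β› with le_total := hβ, toDecidableLE := Classical.decRel _ }
  exact ⟨(@Fintype.orderIsoFinOfCardEq α A _ _ h).symm.trans
    (@Fintype.orderIsoFinOfCardEq β B _ _ rfl)⟩

section Chains

variable {P : Type v} [PartialOrder P] [LocallyFiniteOrder P]

/-- In a chain `z` is comparable to every element, so `[x, y]` is the disjoint union of `[x, z]` and
`(z, y]`. Subtracting one turns cardinality into length, so that the shared point `z` is not counted
twice. -/
theorem card_Icc_add_card_Icc (hT : ∀ x y : P, ∀ u ∈ Set.Icc x y, ∀ v ∈ Set.Icc x y, u ≤ v ∨ v ≤ u)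
    {x z y : P} (h : x ≤ z) (h' : z ≤ y) :
    ((Finset.Icc x z).card - 1) + ((Finset.Icc z y).card - 1) = (Finset.Icc x y).card - 1 := by
  classical
  have h1 : Finset.Icc x y = Finset.Icc x z ∪ Finset.Ioc z y := by
    ext a
    simp only [Finset.mem_union, Finset.mem_Icc, Finset.mem_Ioc]
    constructor
    · intro ha
      rcases eq_or_ne z a with rfl | hne
      · exact Or.inl ⟨h, le_rfl⟩
      rcases hT x y a ha z ⟨h, h'⟩ with h2 | h2
      · exact Or.inl ⟨ha.1, h2⟩
      · exact Or.inr ⟨lt_of_le_of_ne h2 hne, ha.2⟩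
    · rintro (ha | ha)
      · exact ⟨ha.1, ha.2.trans h'⟩
      · exact ⟨h.trans ha.1.le, ha.2⟩
  have h2 : Disjoint (Finset.Icc x z) (Finset.Ioc z y) :=
    Finset.disjoint_left.2 fun a ha hb =>
      ((Finset.mem_Icc.1 ha).2.trans_lt (Finset.mem_Ioc.1 hb).1).false
  rw [h1, Finset.card_union_of_disjoint h2, Finset.card_Ioc_eq_card_Icc_sub_one]
  have : 0 < (Finset.Icc x z).card := Finset.card_pos.2 (Finset.nonempty_Icc.2 h)
  omega

theorem card_Icc_of_covBy {x y : P} (h : x ⋖ y) : (Finset.Icc x y).card = 2 := by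
  classical
  have : Finset.Icc x y = {x, y} := by
    rw [← Finset.coe_inj]
    simpa using h.Icc_eq
  rw [this, Finset.card_pair h.lt.ne]

theorem isIntervalRank_of_total
    (hT : ∀ x y : P, ∀ u ∈ Set.Icc x y, ∀ v ∈ Set.Icc x y, u ≤ v ∨ v ≤ u)
    (hunb : ∀ n : ℕ, ∃ x y : P, x ≤ y ∧ n ≤ (Finset.Icc x y).card - 1) :
    IsIntervalRank (isoSetoid P) fun I => (Finset.Icc I.fst I.snd).card - 1 where
  rel_iff I J := by
    have hc : ∀ K : NonemptyInterval P,
        Fintype.card (Set.Icc K.fst K.snd) = (Finset.Icc K.fst K.snd).card := fun K => by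
      simp
    have hp : ∀ K : NonemptyInterval P, 0 < (Finset.Icc K.fst K.snd).card := fun K =>
      Finset.card_pos.2 (Finset.nonempty_Icc.2 K.fst_le_snd)
    have h1 := hp I
    have h2 := hp J
    constructor
    · rintro ⟨e⟩
      have := Fintype.card_congr e.toEquiv
      rw [hc, hc] at this
      change _ - 1 = _ - 1
      rw [this]
    · intro h
      refine nonempty_orderIso_of_card_eq (fun a b => hT _ _ _ a.2 _ b.2)
        (fun a b => hT _ _ _ a.2 _ b.2) ?_
      rw [hc, hc]
      omega
  add x z y h h' := card_Icc_add_card_Icc hT h h'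
  covBy x y h := by simp [card_Icc_of_covBy h]
  unbounded n := by
    obtain ⟨x, y, h, hn⟩ := hunb n
    exact ⟨⟨(x, y), h⟩, hn⟩

theorem isIntervalRank_nat :
    IsIntervalRank (isoSetoid ℕ) fun I => (Finset.Icc I.fst I.snd).card - 1 :=
  isIntervalRank_of_total (fun _ _ u _ v _ => le_total u v)
    fun n => ⟨0, n, Nat.zero_le n, by simp⟩

/-! ## Forests -/

/-- A saturated chain is a path in the Hasse diagram. The bound on the support strengthens the
induction: it shows that a vertex prepended from below is new. -/
theorem exists_isPath_of_le {x y : P} (h : x ≤ y) :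
    ∃ p : (SimpleGraph.hasse P).Walk x y, p.IsPath ∧ ∀ z ∈ p.support, x ≤ z := by
  induction le_iff_reflTransGen_covBy.1 h using Relation.ReflTransGen.head_induction_on with
  | refl => exact ⟨SimpleGraph.Walk.nil, by simp, by simp⟩
  | head h1 h2 ih =>
    obtain ⟨p, hp, hs⟩ := ih (le_iff_reflTransGen_covBy.2 h2)
    refine ⟨SimpleGraph.Walk.cons (SimpleGraph.hasse_adj.2 (Or.inl h1)) p,
      (SimpleGraph.Walk.cons_isPath_iff _ _).2 ⟨hp, fun hx => (h1.lt.trans_le (hs _ hx)).false⟩,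
      ?_⟩
    intro z hz
    rw [SimpleGraph.Walk.support_cons, List.mem_cons] at hz
    rcases hz with rfl | hz
    · exact le_rfl
    · exact h1.le.trans (hs _ hz)

theorem exists_isPath_through {x u y : P} (h : x ≤ u) (h' : u ≤ y) :
    ∃ p : (SimpleGraph.hasse P).Walk x y, p.IsPath ∧ u ∈ p.support ∧
      ∀ z ∈ p.support, x ≤ z ∧ (z ≤ u ∨ u ≤ z) := by
  induction le_iff_reflTransGen_covBy.1 h using Relation.ReflTransGen.head_induction_on with
  | refl =>
    obtain ⟨p, hp, hs⟩ := exists_isPath_of_le h'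
    exact ⟨p, hp, p.start_mem_support, fun z hz => ⟨hs z hz, Or.inr (hs z hz)⟩⟩
  | head h1 h2 ih =>
    have h3 := le_iff_reflTransGen_covBy.2 h2
    obtain ⟨p, hp, hu, hs⟩ := ih h3
    refine ⟨SimpleGraph.Walk.cons (SimpleGraph.hasse_adj.2 (Or.inl h1)) p,
      (SimpleGraph.Walk.cons_isPath_iff _ _).2
        ⟨hp, fun hx => (h1.lt.trans_le (hs _ hx).1).false⟩, ?_, ?_⟩
    · rw [SimpleGraph.Walk.support_cons]
      exact List.mem_cons_of_mem _ hu
    · intro z hz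
      rw [SimpleGraph.Walk.support_cons, List.mem_cons] at hz
      rcases hz with rfl | hz
      · exact ⟨le_rfl, Or.inl (h1.le.trans h3)⟩
      · exact ⟨h1.le.trans (hs _ hz).1, (hs _ hz).2⟩

/-- A saturated chain from `x` to `y` through `u` and one through `v` are both paths from `x` to
`y`. In a forest they coincide, so `v` lies on a chain through `u`. -/
theorem total_of_isAcyclic (hP : (SimpleGraph.hasse P).IsAcyclic) (x y : P) :
    ∀ u ∈ Set.Icc x y, ∀ v ∈ Set.Icc x y, u ≤ v ∨ v ≤ u := by
  intro u hu v hv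
  obtain ⟨p, hp, -, hs⟩ := exists_isPath_through hu.1 hu.2
  obtain ⟨q, hq, hv', -⟩ := exists_isPath_through hv.1 hv.2
  have := hP.subsingleton_path x y
  have h : p = q := congrArg Subtype.val
    (Subsingleton.elim (⟨p, hp⟩ : (SimpleGraph.hasse P).Path x y) ⟨q, hq⟩)
  exact (hs v (h ▸ hv')).2.symm

theorem isIntervalRank_of_isAcyclic (hP : (SimpleGraph.hasse P).IsAcyclic)
    (hd : hasseDepth P = ⊤) :
    IsIntervalRank (isoSetoid P) fun I => (Finset.Icc I.fst I.snd).card - 1 := by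
  have hT := total_of_isAcyclic hP
  refine isIntervalRank_of_total hT fun n => ?_
  obtain ⟨p, hp⟩ := iSup_eq_top.1 hd n (ENat.natCast_lt_top n)
  -- Lengths add up along the path and each covering step contributes one, so a long oriented path
  -- yields an interval of large rank.
  have key : ∀ i : Fin (p.length + 1), p 0 ≤ p i ∧ (Finset.Icc (p 0) (p i)).card - 1 = i := by
    intro i
    induction i using Fin.induction with
    | zero => simp
    | succ i ih =>
      have hc : p i.castSucc ⋖ p i.succ := p.step i
      refine ⟨ih.1.trans hc.le, ?_⟩
      rw [← card_Icc_add_card_Icc hT ih.1 hc.le, ih.2, card_Icc_of_covBy hc]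
      simp
  refine ⟨_, _, (key (Fin.last _)).1, ?_⟩
  rw [(key (Fin.last _)).2]
  exact le_of_lt (by exact_mod_cast hp)

end Chains

/-! ## Subspaces -/

section Subspaces

variable (F : Type v) [Field F] (V : Type w) [AddCommGroup V] [Module F V]

theorem finrank_quotient_submoduleOf {X Y : Submodule F V} [FiniteDimensional F Y] (h : X ≤ Y) :
    Module.finrank F (Y ⧸ X.submoduleOf Y) + Module.finrank F X = Module.finrank F Y := by
  rw [← (Submodule.submoduleOfEquivOfLe h).finrank_eq, Submodule.finrank_quotient_add_finrank]

/-- Adjoining to `X` one vector of `Y` outside `X` gives a subspace strictly above `X` and inside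
`Y`, hence `Y` itself. -/
theorem finrank_eq_of_covBy {X Y : FinDimSubspace F V} (h : X ⋖ Y) :
    Module.finrank F Y.1 = Module.finrank F X.1 + 1 := by
  have := X.2
  have := Y.2
  obtain ⟨v, hvY, hvX⟩ := SetLike.exists_of_lt (show X.1 < Y.1 from h.lt)
  let Z : FinDimSubspace F V := ⟨X.1 ⊔ Submodule.span F {v}, inferInstance⟩
  have h1 : X < Z := lt_of_le_of_ne (show X.1 ≤ Z.1 from le_sup_left) fun h1 => hvX <| by
    rw [h1]
    exact (le_sup_right : _ ≤ Z.1) (Submodule.mem_span_singleton_self v)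
  have h2 : Z ≤ Y := sup_le h.le ((Submodule.span_singleton_le_iff_mem _ _).2 hvY)
  have h3 : Z = Y := (h.eq_or_eq h1.le h2).resolve_left h1.ne'
  have h4 : Module.finrank F Z.1 ≤ Module.finrank F X.1 + 1 :=
    (Submodule.finrank_add_le_finrank_add_finrank _ _).trans
      (Nat.add_le_add_left (by
        simpa using finrank_span_le_card (R := F) ({v} : Set V)) _)
  have h5 := Submodule.finrank_lt_finrank_of_lt (show X.1 < Y.1 from h.lt)
  rw [h3] at h4
  omega

theorem isIntervalRank_quotientSetoid (hV : Module.rank F V = Cardinal.aleph0) :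
    IsIntervalRank (quotientSetoid F V) fun I =>
      Module.finrank F (I.snd.1 ⧸ I.fst.1.submoduleOf I.snd.1) where
  rel_iff I J := by
    have := I.snd.2
    have := J.snd.2
    exact FiniteDimensional.nonempty_linearEquiv_iff_finrank_eq
  add X Z Y h h' := by
    have := Z.2
    have := Y.2
    have h1 := finrank_quotient_submoduleOf F V (show X.1 ≤ Z.1 from h)
    have h2 := finrank_quotient_submoduleOf F V (show Z.1 ≤ Y.1 from h')
    have h3 := finrank_quotient_submoduleOf F V (show X.1 ≤ Y.1 from h.trans h')
    simp only
    omega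
  covBy X Y h := by
    have := Y.2
    have h1 := finrank_quotient_submoduleOf F V (show X.1 ≤ Y.1 from h.le)
    have h2 := finrank_eq_of_covBy F V h
    simp only
    omega
  unbounded n := by
    -- The witness is the interval from the zero subspace to the span of `n` independent vectors.
    obtain ⟨t, ht, hli⟩ := exists_finset_linearIndependent_of_le_rank (R := F) (M := V) (n := n)
      (hV ▸ Cardinal.natCast_lt_aleph0.le)
    have hfin : FiniteDimensional F (Submodule.span F (t : Set V)) :=
      FiniteDimensional.span_finset F t
    refine ⟨⟨(zeroSubspace F V, ⟨_, hfin⟩), (bot_le : (⊥ : Submodule F V) ≤ _)⟩, ?_⟩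
    have h1 := finrank_quotient_submoduleOf F V
      (bot_le : (⊥ : Submodule F V) ≤ Submodule.span F (t : Set V))
    rw [finrank_span_finset_eq_card hli, finrank_bot, ht, add_zero] at h1
    exact h1.ge

end Subspaces

theorem mainTheorem1 (k : Type u) [Field k] [CharZero k] [TopologicalSpace k] [DiscreteTopology k] :
    -- exponential power series: finite subsets of a countably infinite set
    (∀ (S : Type v) [DecidableEq S] [Countable S] [Infinite S],
      Nonempty (ReducedIncidenceAlgebra.HH k (isoSetoid (Finset S)) ∅ 0 ≃ₗ[k] k) ∧
      Nonempty (ReducedIncidenceAlgebra.HH k (isoSetoid (Finset S)) ∅ 1 ≃ₗ[k] k) ∧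
      ∀ n ≥ 2, Subsingleton (ReducedIncidenceAlgebra.HH k (isoSetoid (Finset S)) ∅ n)) ∧
    -- formal power series: the non-negative integers
    (Nonempty (ReducedIncidenceAlgebra.HH k (isoSetoid ℕ) 0 0 ≃ₗ[k] k) ∧
      Nonempty (ReducedIncidenceAlgebra.HH k (isoSetoid ℕ) 0 1 ≃ₗ[k] k) ∧
      ∀ n ≥ 2, Subsingleton (ReducedIncidenceAlgebra.HH k (isoSetoid ℕ) 0 n)) ∧
    -- Eulerian power series: finite-dimensional subspaces of a vector space of countably infinite
    -- dimension over a finite field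
    (∀ (F : Type v) [Field F] [Finite F] (V : Type w) [AddCommGroup V] [Module F V],
      Module.rank F V = Cardinal.aleph0 →
      Nonempty (ReducedIncidenceAlgebra.HH k (quotientSetoid F V) (zeroSubspace F V) 0
        ≃ₗ[k] k) ∧
      Nonempty (ReducedIncidenceAlgebra.HH k (quotientSetoid F V) (zeroSubspace F V) 1
        ≃ₗ[k] k) ∧
      ∀ n ≥ 2, Subsingleton
        (ReducedIncidenceAlgebra.HH k (quotientSetoid F V) (zeroSubspace F V) n)) ∧
    -- locally finite posets whose Hasse diagram is a forest of infinite depth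
    (∀ (P : Type v) [PartialOrder P] [LocallyFiniteOrder P],
      (SimpleGraph.hasse P).IsAcyclic → hasseDepth P = ⊤ → ∀ x : P,
      Nonempty (ReducedIncidenceAlgebra.HH k (isoSetoid P) x 0 ≃ₗ[k] k) ∧
      Nonempty (ReducedIncidenceAlgebra.HH k (isoSetoid P) x 1 ≃ₗ[k] k) ∧
      ∀ n ≥ 2, Subsingleton (ReducedIncidenceAlgebra.HH k (isoSetoid P) x n)) := by
  refine ⟨fun S _ _ _ => (isIntervalRank_finset S).HH_equiv k ∅, isIntervalRank_nat.HH_equiv k 0,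
    fun F _ _ V _ _ hV => (isIntervalRank_quotientSetoid F V hV).HH_equiv k (zeroSubspace F V),
    fun P _ _ hP hd x => (isIntervalRank_of_isAcyclic hP hd).HH_equiv k x⟩
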